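/- Let $N$ be a positive integer and $\hat t>0$. For $k=1,\dots,N$ let $A_k\in\mathbb{R}^{d_k\times d_k}$, $B_k\in\mathbb{R}^{d_k\times m_k}$, let $\mathbb{U}_k\subset\mathbb{R}^{m_k}$ be a compact set containing $0$, let $\bar x^k,\hat x^k\in\mathbb{R}^{d_k}$, let $\hat Q_k\in\mathbb{R}^{d_k\times d_k}$ be symmetric and non-negative definite, let $\lambda_k>0$, and put $\lambda_k'=\sum_{\ell\neq k}\lambda_\ell$. Let $A,B,\hat Q$ be the block-diagonal matrices with blocks $A_k,B_k,\hat Q_k$, let $\bar x=(\bar x^1,\dots,\bar x^N)$ and $\hat x=(\hat x^1,\dots,\hat x^N)$, and let $\mathbb{U}_{\mathrm{M}}$ be the set of all $\mu=(\mu^1,\dots,\mu^N)$ such that for some $k$ we have $\mu^k\in\mathbb{U}_k$ and $\mu^\ell=0$ for all $\ell\neq k$. Write $\mathbf{1}_{\{0\}}$ for the indicator function of $\{0\}$. Consider the multiplexed sparse Mayer problem $$\text{minimize}\quad -\int_0^{\hat t}\sum_{k=1}^N\lambda_k\mathbf{1}_{\{0\}}(u^k(t))\,\mathrm{d}t+\tfrac12\bigl\langle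 x(\hat t)-\hat x,\hat Q(x(\hat t)-\hat x)\bigr\rangle$$ over all pairs $(x,u)$ on $[0,\hat t]$ with $u=(u^1,\dots,u^N)$ Lebesgue measurable, $u(t)\in\mathbb{U}_{\mathrm{M}}$ for all $t$, and $x$ absolutely continuous with $x(0)=\bar x$ and $\dot x(t)=Ax(t)+Bu(t)$ for a.e. $t$. A local minimizer is a feasible pair $(x_*,u_*)$ for which there is $\varepsilon>0$ such that no feasible pair $(x,u)$ with $\sup_{t\in[0,\hat t]}\|x(t)-x_*(t)\|\le\varepsilon$ has a smaller cost. Let $(x_*,u_*)$ be a local minimizer. Then there exist an absolutely continuous map $p=(p^1,\dots,p^N):[0,\hat t]\to\mathbb{R}^{d_1}\times\cdots\times\mathbb{R}^{d_N}$ and a Lebesgue measurable map $\sigma^{\mathrm{M}}:[0,\hat t]\to\{1,\dots,N\}$ such that $x_*(0)=\bar x$, $p(\hat t)=-\hat Q(x_*(\hat t)-\hat x)$, and for a.e. $t\in[0,\hat t]$: (i) $\dot x_*(t)=Ax_*(t)+Bu_*(t)$ and $\dot p(t)=-A^\top p(t)$; (ii) for every $k\neq\sigma^{\mathrm{M}}(t)$,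 $u_*^k(t)=0$; and for $k=\sigma^{\mathrm{M}}(t)$, with $M_k(t)=\max_{v\in\mathbb{U}_k}\langle B_k^\top p^k(t),v\rangle$, $$u_*^k(t)\in\begin{cases}\operatorname{argmax}_{v\in\mathbb{U}_k}\langle B_k^\top p^k(t),v\rangle&\text{if }M_k(t)>\lambda_k,\\ \{0\}\cup\operatorname{argmax}_{v\in\mathbb{U}_k}\langle B_k^\top p^k(t),v\rangle&\text{if }M_k(t)=\lambda_k,\\ \{0\}&\text{otherwise;}\end{cases}$$ (iii) $\sigma^{\mathrm{M}}(t)\in\operatorname{argmax}_{k\in\{1,\dots,N\}}\ \max_{v\in\mathbb{U}_k}\bigl\{\langle B_k^\top p^k(t),v\rangle+\lambda_k\mathbf{1}_{\{0\}}(v)+\lambda_k'\bigr\}$. Moreover, the map $t\mapsto\langle p(t),Ax_*(t)+Bu_*(t)\rangle+\sum_{k=1}^N\lambda_k\mathbf{1}_{\{0\}}(u_*^k(t))$ is constant a.e. on $[0,\hat t]$. -/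

import Mathlib

open Set MeasureTheory Filter
open scoped Matrix

noncomputable section

namespace SparseMux

/-- The set of maximizers of `f` over `S`. -/
def argmaxOn {α : Type*} (S : Set α) (f : α → ℝ) : Set α :=
  {v | v ∈ S ∧ ∀ w ∈ S, f w ≤ f v}

/-- The maximum of `f` over `S` (a genuine maximum in all uses below, see
`isGreatest_maxOn_hamiltonian`). -/
def maxOn {α : Type*} (S : Set α) (f : α → ℝ) : ℝ := sSup (f '' S)

/-- The indicator function of `{0}`. -/
def indZero {n : ℕ} (v : Fin n → ℝ) : ℝ := ({0} : Set (Fin n → ℝ)).indicator 1 v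

/-- Stacked vectors: `ℝ^{n 1} × ⋯ × ℝ^{n N}`, identified with `ℝ^{n 1 + ⋯ + n N}`. -/
abbrev Stacked {N : ℕ} (n : Fin N → ℕ) : Type := (Σ k, Fin (n k)) → ℝ

/-- The `k`-th block of a stacked vector. -/
def block {N : ℕ} {n : Fin N → ℕ} (z : Stacked n) (k : Fin N) : Fin (n k) → ℝ :=
  fun i => z ⟨k, i⟩

/-- The vector with the given blocks. -/
def stack {N : ℕ} {n : Fin N → ℕ} (z : ∀ k, Fin (n k) → ℝ) : Stacked n :=
  fun i => z i.1 i.2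

/-- The Euclidean norm of a stacked vector. -/
def euclNorm {N : ℕ} {n : Fin N → ℕ} (z : Stacked n) : ℝ := Real.sqrt (z ⬝ᵥ z)

/-- The data of the multiplexed sparse Mayer problem for an ensemble of `N` linear systems
with state dimensions `d k` and control dimensions `m k`. -/
structure MayerData (N : ℕ) (d m : Fin N → ℕ) where
  /-- the system matrices -/
  A : ∀ k, Matrix (Fin (d k)) (Fin (d k)) ℝ
  /-- the input matrices -/
  B : ∀ k, Matrix (Fin (d k)) (Fin (m k)) ℝ
  /-- the sets of admissible control actions -/
  U : ∀ k, Set (Fin (m k) → ℝ)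
  /-- the initial states -/
  xInit : ∀ k, Fin (d k) → ℝ
  /-- the desired final states -/
  xFin : ∀ k, Fin (d k) → ℝ
  /-- the terminal weights -/
  Qhat : ∀ k, Matrix (Fin (d k)) (Fin (d k)) ℝ
  /-- the weights of the sparsity terms -/
  lam : Fin N → ℝ
  /-- the final time -/
  T : ℝ

namespace MayerData

variable {N : ℕ} {d m : Fin N → ℕ} (P : MayerData N d m)

/-- The joint system matrix. -/
def jointA : Matrix (Σ k, Fin (d k)) (Σ k, Fin (d k)) ℝ := Matrix.blockDiagonal' P.A

/-- The joint input matrix. -/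
def jointB : Matrix (Σ k, Fin (d k)) (Σ k, Fin (m k)) ℝ := Matrix.blockDiagonal' P.B

/-- The joint terminal weight. -/
def jointQhat : Matrix (Σ k, Fin (d k)) (Σ k, Fin (d k)) ℝ := Matrix.blockDiagonal' P.Qhat

/-- `∑_{ℓ ≠ k} λ_ℓ`. -/
def lamCompl (k : Fin N) : ℝ := ∑ l ∈ Finset.univ.erase k, P.lam l

/-- The admissible joint actions: some block `k` lies in `U k`, the others vanish. -/
def admissibleActions : Set (Stacked m) :=
  {μ | ∃ k, block μ k ∈ P.U k ∧ ∀ l, l ≠ k → block μ l = 0}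

/-- The state-action trajectory `(x, u)` on `[0, T]` satisfies the constraints: `u` is Lebesgue
measurable with values in the admissible joint actions, and `x` is the Carathéodory solution of
the joint system under `u` that starts at the initial state. Values outside `[0, T]` play no role. -/
structure IsAdmissible (x : ℝ → Stacked d) (u : ℝ → Stacked m) : Prop where
  measurable : AEMeasurable u (volume.restrict (Icc 0 P.T))
  mem : ∀ t ∈ Icc 0 P.T, u t ∈ P.admissibleActions
  absCont : AbsolutelyContinuousOnInterval x 0 P.T
  init : x 0 = stack P.xInit
  dynamics : ∀ᵐ t ∂(volume.restrict (Icc 0 P.T)),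
    HasDerivAt x (P.jointA *ᵥ x t + P.jointB *ᵥ u t) t

/-- The objective function. -/
def cost (x : ℝ → Stacked d) (u : ℝ → Stacked m) : ℝ :=
  -(∫ t in (0 : ℝ)..P.T, ∑ k, P.lam k * indZero (block (u t) k)) +
    (1 / 2) * ((x P.T - stack P.xFin) ⬝ᵥ (P.jointQhat *ᵥ (x P.T - stack P.xFin)))

/-- Local minimizers: `(x, u)` satisfies the constraints, and no state-action trajectory that
satisfies them and whose state is uniformly close to `x` on `[0, T]` has a smaller cost. -/
def IsLocalMinimizer (x : ℝ → Stacked d) (u : ℝ → Stacked m) : Prop :=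
  P.IsAdmissible x u ∧
    ∃ ε > 0, ∀ (y : ℝ → Stacked d) (v : ℝ → Stacked m), P.IsAdmissible y v →
      (∀ t ∈ Icc 0 P.T, euclNorm (y t - x t) ≤ ε) → P.cost x u ≤ P.cost y v

/-- `v ↦ ⟨B_kᵀ q, v⟩`. -/
def gain (k : Fin N) (q : Fin (d k) → ℝ) (v : Fin (m k) → ℝ) : ℝ :=
  ((P.B k)ᵀ *ᵥ q) ⬝ᵥ v

/-- `max_{v ∈ U_k} ⟨B_kᵀ q, v⟩`. -/
def maxGain (k : Fin N) (q : Fin (d k) → ℝ) : ℝ := maxOn (P.U k) (P.gain k q)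

/-- `max_{v ∈ U_k} {⟨B_kᵀ q, v⟩ + λ_k 1_{0}(v) + λ'_k}`. -/
def maxHamiltonian (k : Fin N) (q : Fin (d k) → ℝ) : ℝ :=
  maxOn (P.U k) (fun v => P.gain k q v + P.lam k * indZero v + P.lamCompl k)

open Classical in
/-- The set of candidate control actions of the active system `k` with adjoint `q`. -/
def activeSet (k : Fin N) (q : Fin (d k) → ℝ) : Set (Fin (m k) → ℝ) :=
  if P.lam k < P.maxGain k q then argmaxOn (P.U k) (P.gain k q)
  else if P.maxGain k q = P.lam k then {0} ∪ argmaxOn (P.U k) (P.gain k q)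
  else {0}

end MayerData

/-- The maxima above are attained. -/
theorem isGreatest_maxOn_hamiltonian {n : ℕ} {S : Set (Fin n → ℝ)} (hS : IsCompact S)
    (h0 : (0 : Fin n → ℝ) ∈ S) (c : Fin n → ℝ) {a : ℝ} (ha : 0 ≤ a) (b : ℝ) :
    IsGreatest ((fun v => c ⬝ᵥ v + a * indZero v + b) '' S)
      (maxOn S (fun v => c ⬝ᵥ v + a * indZero v + b)) := by
  have hcont : Continuous fun v : Fin n → ℝ => c ⬝ᵥ v := by
    unfold dotProduct; fun_prop
  obtain ⟨w, hw, hmax⟩ := hS.exists_isMaxOn ⟨0, h0⟩ hcont.continuousOn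
  have key : ∃ w ∈ S, ∀ v ∈ S,
      c ⬝ᵥ v + a * indZero v + b ≤ c ⬝ᵥ w + a * indZero w + b := by
    have hz : indZero (0 : Fin n → ℝ) = 1 := by simp [indZero]
    have hnz : ∀ v : Fin n → ℝ, v ≠ 0 → indZero v = 0 := fun v hv => by simp [indZero, hv]
    have hnn : ∀ v : Fin n → ℝ, 0 ≤ indZero v := fun v => by
      by_cases hv : v = 0
      · subst hv; rw [hz]; norm_num
      · rw [hnz v hv]
    by_cases hle : c ⬝ᵥ w ≤ a
    · refine ⟨0, h0, fun v hv => ?_⟩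
      by_cases hv0 : v = 0
      · subst hv0; exact le_rfl
      · have := hmax hv
        simp only [mem_ofPred_eq] at this
        rw [hnz v hv0, hz, dotProduct_zero]; linarith
    · refine ⟨w, hw, fun v hv => ?_⟩
      have h1 := mul_nonneg ha (hnn w)
      by_cases hv0 : v = 0
      · subst hv0; rw [hz, dotProduct_zero]; linarith [not_le.1 hle]
      · have := hmax hv
        simp only [mem_ofPred_eq] at this
        rw [hnz v hv0]; linarith
  obtain ⟨w, hw, h⟩ := key
  have hg : IsGreatest ((fun v => c ⬝ᵥ v + a * indZero v + b) '' S)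
      (c ⬝ᵥ w + a * indZero w + b) :=
    ⟨⟨w, hw, rfl⟩, by rintro _ ⟨v, hv, rfl⟩; exact h v hv⟩
  rw [maxOn, hg.csSup_eq]; exact hg

end SparseMux

end

/-! The argument is Pontryagin's, by needle variations. The dynamics are linear and the terminal
state is free, so replacing `u` by a constant action `v` on a short interval stays feasible and
shifts the state by an explicit forced response. Expanding the quadratic terminal cost and moving
its linear part along the costate gives the cost change exactly (`IsAdmissible.cost_add_needle`):
minus the integral of the Hamiltonian gap over the interval, plus a quadratic form in the terminal
shift. The shift is linear in the length `r` (`exists_norm_needleResponse_le`), so for small `r` the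
competitor is close enough for local minimality, and the quadratic term is `O(r ^ 2)`. Dividing by
`r` at points where the integral of the Hamiltonian has the expected derivative gives the maximum
condition.

An admissible action has at most one nonzero block, and each silent block earns its full `λ`; the
joint condition therefore splits into a choice of index and a single-system maximization
(`mem_argmaxOn_maxHamiltonian`). The index `σ` reads off the nonzero block of `u`.

For constancy, the maximized Hamiltonian is Lipschitz in the costate, hence absolutely continuous in
time even though `u` is only measurable. An envelope argument shows that the derivative of the full
Hamiltonian vanishes almost everywhere. -/

/-! ### Closure properties of absolute continuity. -/

section AbsolutelyContinuous

theorem AbsolutelyContinuousOnInterval.lipschitz_comp {X Y : Type*} [PseudoMetricSpace X]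
    [PseudoMetricSpace Y] {f : ℝ → X} {φ : X → Y} {a b : ℝ} {K : NNReal}
    (hf : AbsolutelyContinuousOnInterval f a b) (hφ : LipschitzWith K φ) :
    AbsolutelyContinuousOnInterval (fun t => φ (f t)) a b := by
  rw [absolutelyContinuousOnInterval_iff] at hf ⊢
  intro ε hε
  -- The `+ 1` covers `K = 0`.
  obtain ⟨δ, hδ, h⟩ := hf (ε / (K + 1)) (by positivity)
  refine ⟨δ, hδ, fun E hE hlen => ?_⟩
  have h1 := h E hE hlen
  calc _ ≤ ∑ i ∈ Finset.range E.1, K * dist (f (E.2 i).1) (f (E.2 i).2) :=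
        Finset.sum_le_sum fun i _ => hφ.dist_le_mul _ _
    _ = K * ∑ i ∈ Finset.range E.1, dist (f (E.2 i).1) (f (E.2 i).2) := by
        rw [Finset.mul_sum]
    _ ≤ K * (ε / (K + 1)) := by gcongr
    _ < (K + 1) * (ε / (K + 1)) := by gcongr; linarith
    _ = ε := by field

theorem AbsolutelyContinuousOnInterval.congr_on {X : Type*} [PseudoMetricSpace X] {f g : ℝ → X}
    {a b : ℝ} (h : ∀ t ∈ uIcc a b, f t = g t) (hg : AbsolutelyContinuousOnInterval g a b) :
    AbsolutelyContinuousOnInterval f a b := by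
  rw [absolutelyContinuousOnInterval_iff] at hg ⊢
  intro ε hε
  obtain ⟨δ, hδ, H⟩ := hg ε hε
  refine ⟨δ, hδ, fun E hE hlen => ?_⟩
  convert H E hE hlen using 2 with i hi
  rw [h _ (hE.1 i hi).1, h _ (hE.1 i hi).2]

theorem AbsolutelyContinuousOnInterval.finset_sum {ι F : Type*} [NormedAddCommGroup F]
    (s : Finset ι) {f : ι → ℝ → F} {a b : ℝ}
    (hf : ∀ i ∈ s, AbsolutelyContinuousOnInterval (f i) a b) :
    AbsolutelyContinuousOnInterval (fun t => ∑ i ∈ s, f i t) a b := by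
  classical
  induction s using Finset.induction_on with
  | empty =>
    simp only [Finset.sum_empty]
    exact (LipschitzWith.const (0 : F)).lipschitzOnWith.absolutelyContinuousOnInterval
  | insert i s hi ih =>
    simp only [Finset.sum_insert hi]
    exact (hf i (by simp)).add (ih fun j hj => hf j (by simp [hj]))

theorem AbsolutelyContinuousOnInterval.eval_pi {ι : Type*} [Fintype ι] {f : ℝ → ι → ℝ} {a b : ℝ}
    (hf : AbsolutelyContinuousOnInterval f a b) (i : ι) :
    AbsolutelyContinuousOnInterval (fun t => f t i) a b :=
  hf.lipschitz_comp (LipschitzWith.eval i)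

theorem AbsolutelyContinuousOnInterval.dotProduct {ι : Type*} [Fintype ι] {f g : ℝ → ι → ℝ}
    {a b : ℝ} (hf : AbsolutelyContinuousOnInterval f a b)
    (hg : AbsolutelyContinuousOnInterval g a b) :
    AbsolutelyContinuousOnInterval (fun t => f t ⬝ᵥ g t) a b :=
  AbsolutelyContinuousOnInterval.finset_sum _ fun i _ => (hf.eval_pi i).mul (hg.eval_pi i)

/-- The product is the combination of the columns of `M` with coefficients `c`; working by columns
avoids choosing a norm on matrices. -/
theorem AbsolutelyContinuousOnInterval.mulVec {ι κ : Type*} [Fintype ι] [Fintype κ]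
    {M : ℝ → Matrix ι κ ℝ} {c : ℝ → κ → ℝ} {a b : ℝ}
    (hM : ∀ j, AbsolutelyContinuousOnInterval (fun t i => M t i j) a b)
    (hc : ∀ j, AbsolutelyContinuousOnInterval (fun t => c t j) a b) :
    AbsolutelyContinuousOnInterval (fun t => M t *ᵥ c t) a b := by
  have h := AbsolutelyContinuousOnInterval.finset_sum Finset.univ
    fun j _ => (hc j).fun_smul (hM j)
  refine cast ?_ h
  congr 1
  ext t i
  simp [Matrix.mulVec, _root_.dotProduct, Finset.sum_apply, mul_comm]

end AbsolutelyContinuous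

/-! ### Product rules for derivatives. -/

section Derivatives

theorem HasDerivAt.dotProduct {ι : Type*} [Fintype ι] {f g : ℝ → ι → ℝ} {f' g' : ι → ℝ} {t : ℝ}
    (hf : HasDerivAt f f' t) (hg : HasDerivAt g g' t) :
    HasDerivAt (fun s => f s ⬝ᵥ g s) (f' ⬝ᵥ g t + f t ⬝ᵥ g') t := by
  have h := HasDerivAt.fun_sum (u := Finset.univ) fun i _ =>
    (hasDerivAt_pi.1 hf i).fun_mul (hasDerivAt_pi.1 hg i)
  simpa only [_root_.dotProduct, ← Finset.sum_add_distrib] using h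

theorem HasDerivAt.mulVec {ι κ : Type*} [Finite ι] [Fintype κ] {M : ℝ → Matrix ι κ ℝ}
    {M' : Matrix ι κ ℝ} {c : ℝ → κ → ℝ} {c' : κ → ℝ} {t : ℝ} (hM : ∀ i j, HasDerivAt (fun s => M s i j) (M' i j) t)
    (hc : HasDerivAt c c' t) :
    HasDerivAt (fun s => M s *ᵥ c s) (M' *ᵥ c t + M t *ᵥ c') t :=
  hasDerivAt_pi.2 fun i =>
    (hasDerivAt_pi.2 (hM i) : HasDerivAt (fun s => M s i) (M' i) t).dotProduct hc

end Derivatives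

/-! ### The matrix exponential in time. -/

section MatrixExponential

variable {ι : Type*} [Fintype ι] [DecidableEq ι] (A : Matrix ι ι ℝ)

open NormedSpace

-- Stated entrywise, so that the matrix norm needed for the proof does not leak into the statement.
attribute [local instance] Matrix.linftyOpNormedRing Matrix.linftyOpNormedAlgebra in
theorem hasDerivAt_exp_smul_matrix (t : ℝ) (i j : ι) :
    HasDerivAt (fun s : ℝ => exp (s • A) i j) ((A * exp (t • A)) i j) t :=
  hasDerivAt_pi.1 (hasDerivAt_pi.1 (hasDerivAt_exp_smul_const' A t) i) j

theorem continuous_exp_smul_matrix : Continuous fun t : ℝ => exp (t • A) :=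
  continuous_pi fun i => continuous_pi fun j =>
    continuous_iff_continuousAt.2 fun t => (hasDerivAt_exp_smul_matrix A t i j).continuousAt

theorem absolutelyContinuousOnInterval_exp_smul_matrix (a b : ℝ) (j : ι) :
    AbsolutelyContinuousOnInterval (fun (t : ℝ) i => exp (t • A) i j) a b := by
  refine ContDiff.contDiffOn ?_ |>.absolutelyContinuousOnInterval
  have hd : ∀ t : ℝ, HasDerivAt (fun (t : ℝ) i => exp (t • A) i j)
      (fun i => (A * exp (t • A)) i j) t :=
    fun t => hasDerivAt_pi.2 fun i => hasDerivAt_exp_smul_matrix A t i j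
  refine contDiff_one_iff_deriv.2 ⟨fun t => (hd t).differentiableAt, ?_⟩
  rw [funext fun t => (hd t).deriv]
  have := continuous_exp_smul_matrix A
  exact continuous_pi fun i => (continuous_const.matrix_mul this).matrix_elem i j

theorem hasDerivAt_exp_smul_mulVec (z : ι → ℝ) (t : ℝ) :
    HasDerivAt (fun s : ℝ => exp (s • A) *ᵥ z) (A *ᵥ (exp (t • A) *ᵥ z)) t := by
  simpa using HasDerivAt.mulVec (hasDerivAt_exp_smul_matrix A t) (hasDerivAt_const t z)

attribute [local instance] Matrix.linftyOpNormedRing Matrix.linftyOpNormedAlgebra in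
theorem exists_norm_exp_smul_mulVec_le (a b : ℝ) :
    ∃ K, 0 ≤ K ∧ ∀ t ∈ Icc a b, ∀ z : ι → ℝ, ‖exp (t • A) *ᵥ z‖ ≤ K * ‖z‖ := by
  obtain ⟨K, hK⟩ := (isCompact_Icc (a := a) (b := b)).exists_bound_of_continuousOn
    (continuous_exp_smul_matrix A).continuousOn
  refine ⟨max K 0, le_max_right _ _, fun t ht z => ?_⟩
  exact (Matrix.linfty_opNorm_mulVec _ _).trans
    (mul_le_mul_of_nonneg_right ((hK t ht).trans (le_max_left _ _)) (norm_nonneg _))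

theorem exp_add_smul_matrix (s t : ℝ) : exp ((s + t) • A) = exp (s • A) * exp (t • A) := by
  rw [add_smul]
  exact Matrix.exp_add_of_commute _ _ (((Commute.refl A).smul_left s).smul_right t)

end MatrixExponential

/-! ### Vector-valued interval integrals. -/

section Integrals

variable {ι : Type*} [Fintype ι] {f : ℝ → ι → ℝ}

theorem IntervalIntegrable.of_eval_pi {κ : Type*} [Fintype κ] {g : ℝ → κ → ℝ} {a b : ℝ}
    (hg : ∀ k, IntervalIntegrable (fun s => g s k) volume a b) :
    IntervalIntegrable g volume a b :=
  ⟨Integrable.of_eval fun k => (hg k).1, Integrable.of_eval fun k => (hg k).2⟩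

theorem IntervalIntegrable.eval_pi {κ : Type*} [Fintype κ] {g : ℝ → κ → ℝ} {a b : ℝ}
    (hg : IntervalIntegrable g volume a b) (k : κ) :
    IntervalIntegrable (fun s => g s k) volume a b :=
  ⟨Integrable.eval hg.1 k, Integrable.eval hg.2 k⟩

theorem IntervalIntegrable.continuous_mulVec {κ : Type*} [Fintype κ] {M : ℝ → Matrix κ ι ℝ}
    {a b : ℝ} (hM : Continuous M) (hf : IntervalIntegrable f volume a b) :
    IntervalIntegrable (fun s => M s *ᵥ f s) volume a b := by
  refine IntervalIntegrable.of_eval_pi fun k => ?_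
  have h := IntervalIntegrable.sum Finset.univ fun j _ =>
    (hf.eval_pi j).continuousOn_mul (hM.matrix_elem k j).continuousOn
  refine h.congr fun s _ => ?_
  simp [Matrix.mulVec, _root_.dotProduct]

theorem dotProduct_intervalIntegral {a b : ℝ} (q : ι → ℝ) (hf : IntervalIntegrable f volume a b) :
    q ⬝ᵥ (∫ s in a..b, f s) = ∫ s in a..b, q ⬝ᵥ f s := by
  let L : (ι → ℝ) →L[ℝ] ℝ := LinearMap.toContinuousLinearMap (dotProductBilin ℝ ℝ q)
  exact (L.intervalIntegral_comp_comm hf).symm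

end Integrals

/-! ### Variation of constants and the adjoint equation. -/

section VariationOfConstants

open NormedSpace

variable {ι : Type*} [Fintype ι] [DecidableEq ι] (A : Matrix ι ι ℝ)

/-- The solution of `ẏ = A y + f`, `y 0 = 0`. -/
noncomputable def forcedResponse (f : ℝ → ι → ℝ) (t : ℝ) : ι → ℝ :=
  exp (t • A) *ᵥ ∫ s in (0 : ℝ)..t, exp (-s • A) *ᵥ f s

variable {A} {f : ℝ → ι → ℝ} {T : ℝ}

theorem forcedResponse_zero : forcedResponse A f 0 = 0 := by simp [forcedResponse]

theorem absolutelyContinuousOnInterval_forcedResponse (hf : IntervalIntegrable f volume 0 T) :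
    AbsolutelyContinuousOnInterval (forcedResponse A f) 0 T := by
  refine AbsolutelyContinuousOnInterval.mulVec
    (fun j => absolutelyContinuousOnInterval_exp_smul_matrix A 0 T j) ?_
  have hg : IntervalIntegrable (fun s => exp (-s • A) *ᵥ f s) volume 0 T :=
    hf.continuous_mulVec ((continuous_exp_smul_matrix A).comp continuous_neg)
  intro j
  have heq : ∀ t ∈ uIcc 0 T, (∫ s in (0 : ℝ)..t, exp (-s • A) *ᵥ f s) j =
      ∫ s in (0 : ℝ)..t, (exp (-s • A) *ᵥ f s) j := fun t ht => by
    simpa using dotProduct_intervalIntegral (Pi.single j 1)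
      (hg.mono_set (uIcc_subset_uIcc_left ht))
  refine AbsolutelyContinuousOnInterval.congr_on heq ?_
  exact (hg.eval_pi j).absolutelyContinuousOnInterval_intervalIntegral (by simp)

/-- Lebesgue differentiation of the integral and the product rule; the forcing survives because `exp
(t • A)` cancels `exp (-t • A)`. -/
theorem ae_hasDerivAt_forcedResponse (hf : IntervalIntegrable f volume 0 T) :
    ∀ᵐ t, t ∈ uIcc 0 T →
      HasDerivAt (forcedResponse A f) (A *ᵥ forcedResponse A f t + f t) t := by
  have hg : IntervalIntegrable (fun s => exp (-s • A) *ᵥ f s) volume 0 T :=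
    hf.continuous_mulVec ((continuous_exp_smul_matrix A).comp continuous_neg)
  filter_upwards [hg.ae_hasDerivAt_integral] with t ht htm
  have h := HasDerivAt.mulVec (hasDerivAt_exp_smul_matrix A t) (ht htm 0 (by simp))
  refine HasDerivAt.congr_deriv h ?_
  rw [Matrix.mulVec_mulVec (f t), ← exp_add_smul_matrix, forcedResponse, Matrix.mulVec_mulVec]
  simp

/-- The constant does not depend on `f`, and the bound is in the `L¹` norm: a bounded forcing on a
short interval has a response proportional to its length. -/
theorem exists_norm_forcedResponse_le (A : Matrix ι ι ℝ) (hT : 0 ≤ T) :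
    ∃ K, 0 ≤ K ∧ ∀ f : ℝ → ι → ℝ, IntervalIntegrable f volume 0 T → ∀ t ∈ Icc 0 T,
      ‖forcedResponse A f t‖ ≤ K * ∫ s in (0 : ℝ)..T, ‖f s‖ := by
  -- The interval is symmetric because both `exp (t • A)` and `exp (-s • A)` must be bounded.
  obtain ⟨K, hK0, hK⟩ := exists_norm_exp_smul_mulVec_le A (-T) T
  refine ⟨K * K, by positivity, fun f hf t ht => ?_⟩
  refine (hK t ⟨by linarith [ht.1], ht.2⟩ _).trans ?_
  rw [mul_assoc]
  gcongr
  have hft : IntervalIntegrable f volume 0 t := hf.mono_set (by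
    rw [uIcc_of_le ht.1, uIcc_of_le hT]; exact Icc_subset_Icc_right ht.2)
  calc _ ≤ ∫ s in (0 : ℝ)..t, K * ‖f s‖ := by
        refine intervalIntegral.norm_integral_le_of_norm_le ht.1 (ae_of_all _ fun s hs => ?_)
          (hft.norm.const_mul K)
        exact hK _ ⟨by linarith [hs.2, ht.2], by linarith [hs.1]⟩ _
    _ = K * ∫ s in (0 : ℝ)..t, ‖f s‖ := intervalIntegral.integral_const_mul _ _
    _ ≤ K * ∫ s in (0 : ℝ)..T, ‖f s‖ := by
        gcongr
        exact intervalIntegral.integral_mono_interval le_rfl ht.1 ht.2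
          (ae_of_all _ fun s => norm_nonneg _) hf.norm

/-- The solution of the adjoint equation `ṗ = -Aᵀ p` with `p T = q`. -/
noncomputable def adjointResponse (A : Matrix ι ι ℝ) (T : ℝ) (q : ι → ℝ) (t : ℝ) : ι → ℝ :=
  exp ((T - t) • Aᵀ) *ᵥ q

theorem adjointResponse_terminal (q : ι → ℝ) : adjointResponse A T q T = q := by
  simp [adjointResponse]

theorem hasDerivAt_adjointResponse (q : ι → ℝ) (t : ℝ) :
    HasDerivAt (adjointResponse A T q) (-(Aᵀ *ᵥ adjointResponse A T q t)) t := by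
  have h := (hasDerivAt_exp_smul_mulVec Aᵀ q (T - t)).scomp t ((hasDerivAt_id t).const_sub T)
  refine HasDerivAt.congr_deriv h ?_
  simp [adjointResponse]

theorem continuous_adjointResponse (q : ι → ℝ) : Continuous (adjointResponse A T q) :=
  continuous_iff_continuousAt.2 fun t => (hasDerivAt_adjointResponse q t).continuousAt

theorem absolutelyContinuousOnInterval_adjointResponse (q : ι → ℝ) (a b : ℝ) :
    AbsolutelyContinuousOnInterval (adjointResponse A T q) a b := by
  refine ContDiff.contDiffOn ?_ |>.absolutelyContinuousOnInterval
  refine contDiff_one_iff_deriv.2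
    ⟨fun t => (hasDerivAt_adjointResponse q t).differentiableAt, ?_⟩
  have hd : deriv (adjointResponse A T q) = fun t => -(Aᵀ *ᵥ adjointResponse A T q t) :=
    funext fun t => (hasDerivAt_adjointResponse q t).deriv
  rw [hd]
  exact (continuous_const.matrix_mulVec (continuous_adjointResponse q)).neg

/-- Duality: transposing `exp ((T - s) • A)` onto `q` turns the first variation of the terminal cost
into an integral along the costate. -/
theorem dotProduct_forcedResponse (q : ι → ℝ) (hf : IntervalIntegrable f volume 0 T) :
    q ⬝ᵥ forcedResponse A f T = ∫ s in (0 : ℝ)..T, adjointResponse A T q s ⬝ᵥ f s := by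
  have hg : IntervalIntegrable (fun s => exp (-s • A) *ᵥ f s) volume 0 T :=
    hf.continuous_mulVec ((continuous_exp_smul_matrix A).comp continuous_neg)
  rw [forcedResponse, Matrix.dotProduct_mulVec, dotProduct_intervalIntegral _ hg]
  refine intervalIntegral.integral_congr fun s _ => ?_
  simp only [adjointResponse]
  rw [← Matrix.dotProduct_mulVec, Matrix.mulVec_mulVec, ← exp_add_smul_matrix,
    Matrix.dotProduct_mulVec, ← Matrix.mulVec_transpose, ← Matrix.exp_transpose,
    Matrix.transpose_smul, ← sub_eq_add_neg]

end VariationOfConstants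

/-! ### Elementary estimates. -/

noncomputable section

theorem exists_dotProduct_mulVec_le {ι κ : Type*} [Fintype ι] [Fintype κ] (Q : Matrix ι κ ℝ) :
    ∃ C, 0 ≤ C ∧ ∀ (y : ι → ℝ) (z : κ → ℝ), |y ⬝ᵥ (Q *ᵥ z)| ≤ C * ‖y‖ * ‖z‖ := by
  refine ⟨∑ i, ∑ j, |Q i j|, by positivity, fun y z => ?_⟩
  simp only [dotProduct, Matrix.mulVec, Finset.mul_sum, Finset.sum_mul]
  refine (Finset.abs_sum_le_sum_abs _ _).trans (Finset.sum_le_sum fun i _ => ?_)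
  refine (Finset.abs_sum_le_sum_abs _ _).trans (Finset.sum_le_sum fun j _ => ?_)
  rw [abs_mul, abs_mul]
  calc |y i| * (|Q i j| * |z j|) ≤ ‖y‖ * (|Q i j| * ‖z‖) := by
        gcongr
        · exact norm_le_pi_norm y i
        · exact norm_le_pi_norm z j
    _ = |Q i j| * ‖y‖ * ‖z‖ := by ring

/-- A function whose increments on the right of `τ` are at most quadratic has a non-positive
derivative at `τ`. -/
theorem HasDerivAt.nonpos_of_sub_le_sq {Φ : ℝ → ℝ} {Φ' τ C h₀ : ℝ} (hΦ : HasDerivAt Φ Φ' τ)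
    (h₀pos : 0 < h₀) (hC : ∀ h ∈ Ioo 0 h₀, Φ (τ + h) - Φ τ ≤ C * h ^ 2) : Φ' ≤ 0 := by
  have h1 : Tendsto (fun h : ℝ => h⁻¹ • (Φ (τ + h) - Φ τ)) (nhdsWithin 0 (Ioi 0)) (nhds Φ') :=
    (hasDerivAt_iff_tendsto_slope_zero.1 hΦ).mono_left
      (nhdsWithin_mono _ fun h (hh : 0 < h) => hh.ne')
  have h2 : Tendsto (fun h : ℝ => C * h) (nhdsWithin 0 (Ioi 0)) (nhds 0) := by
    have : Tendsto (fun h : ℝ => C * h) (nhds 0) (nhds (C * 0)) :=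
      (continuous_const.mul continuous_id).tendsto 0
    rw [mul_zero] at this
    exact this.mono_left nhdsWithin_le_nhds
  refine le_of_tendsto_of_tendsto h1 h2 ?_
  filter_upwards [Ioo_mem_nhdsGT h₀pos] with h hh
  rw [smul_eq_mul, inv_mul_le_iff₀ hh.1]
  calc _ ≤ C * h ^ 2 := hC h hh
    _ = h * (C * h) := by ring

namespace SparseMux

theorem measurable_indZero {n : ℕ} : Measurable (indZero : (Fin n → ℝ) → ℝ) :=
  measurable_one.indicator (measurableSet_singleton 0)

theorem indZero_zero {n : ℕ} : indZero (0 : Fin n → ℝ) = 1 := by simp [indZero]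

theorem indZero_of_ne {n : ℕ} {v : Fin n → ℝ} (hv : v ≠ 0) : indZero v = 0 := by
  simp [indZero, hv]

theorem indZero_nonneg {n : ℕ} (v : Fin n → ℝ) : 0 ≤ indZero v :=
  indicator_nonneg (fun _ _ => zero_le_one) v

theorem indZero_le_one {n : ℕ} (v : Fin n → ℝ) : indZero v ≤ 1 :=
  indicator_le_self' (fun _ _ => zero_le_one) v

theorem continuous_block {N : ℕ} {n : Fin N → ℕ} (k : Fin N) :
    Continuous fun z : Stacked n => block z k :=
  continuous_pi fun i => continuous_apply (⟨k, i⟩ : Σ k, Fin (n k))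

/-- Local minimality is measured in the Euclidean norm, while the state estimates use the sup norm
of the function type. -/
theorem exists_euclNorm_le {N : ℕ} (n : Fin N → ℕ) :
    ∃ C, 0 ≤ C ∧ ∀ z : Stacked n, euclNorm z ≤ C * ‖z‖ := by
  obtain ⟨C, hC0, hC⟩ := exists_dotProduct_mulVec_le
    (1 : Matrix (Σ k, Fin (n k)) (Σ k, Fin (n k)) ℝ)
  refine ⟨Real.sqrt C, Real.sqrt_nonneg _, fun z => ?_⟩
  have h := (le_abs_self _).trans (hC z z)
  rw [Matrix.one_mulVec, mul_assoc] at h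
  calc euclNorm z ≤ Real.sqrt (C * (‖z‖ * ‖z‖)) := Real.sqrt_le_sqrt h
    _ = Real.sqrt C * ‖z‖ := by
      rw [Real.sqrt_mul hC0, Real.sqrt_mul_self (norm_nonneg _)]

/-! ### Bounds and integrability of the Hamiltonian. -/

namespace MayerData

variable {N : ℕ} {d m : Fin N → ℕ} (P : MayerData N d m)

/-- The sparsity reward `∑_k λ_k 1_{0}(v^k)`. -/
def reward (v : Stacked m) : ℝ := ∑ k, P.lam k * indZero (block v k)

/-- The Hamiltonian without its drift term: `⟨q, B v⟩ + ∑_k λ_k 1_{0}(v^k)`. -/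
def controlHamiltonian (q : Stacked d) (v : Stacked m) : ℝ :=
  q ⬝ᵥ (P.jointB *ᵥ v) + P.reward v

theorem measurable_reward : Measurable P.reward :=
  Finset.measurable_sum _ fun k _ =>
    (measurable_indZero.comp (continuous_block k).measurable).const_mul _

theorem exists_abs_reward_le : ∃ C, ∀ v, |P.reward v| ≤ C := by
  refine ⟨∑ k, |P.lam k|, fun v => (Finset.abs_sum_le_sum_abs _ _).trans
    (Finset.sum_le_sum fun k _ => ?_)⟩
  rw [abs_mul, abs_of_nonneg (indZero_nonneg _)]
  exact mul_le_of_le_one_right (abs_nonneg _) (indZero_le_one _)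

theorem exists_norm_le_of_mem_admissibleActions (hU : ∀ k, IsCompact (P.U k)) :
    ∃ R, 0 ≤ R ∧ ∀ v ∈ P.admissibleActions, ‖v‖ ≤ R := by
  choose R hR using fun k => (hU k).isBounded.exists_norm_le
  refine ⟨∑ k, |R k|, by positivity, ?_⟩
  rintro v ⟨k, hk, hne⟩
  refine (pi_norm_le_iff_of_nonneg (by positivity)).2 fun ⟨l, i⟩ => ?_
  by_cases hl : l = k
  · subst hl
    calc ‖v ⟨l, i⟩‖ ≤ ‖block v l‖ := norm_le_pi_norm (block v l) i
      _ ≤ |R l| := (hR l _ hk).trans (le_abs_self _)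
      _ ≤ ∑ k, |R k| := Finset.single_le_sum (f := fun k => |R k|)
        (fun _ _ => abs_nonneg _) (Finset.mem_univ l)
  · have : v ⟨l, i⟩ = 0 := congrFun (hne l hl) i
    rw [this, norm_zero]; positivity

/-- The reward cancels and the rest is linear in the costate. Uniformity in `v` is what makes the
supremum over actions Lipschitz. -/
theorem exists_abs_controlHamiltonian_sub_le (hU : ∀ k, IsCompact (P.U k)) :
    ∃ C, 0 ≤ C ∧ ∀ v ∈ P.admissibleActions, ∀ q q' : Stacked d,
      |P.controlHamiltonian q v - P.controlHamiltonian q' v| ≤ C * ‖q - q'‖ := by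
  obtain ⟨R, hR0, hR⟩ := P.exists_norm_le_of_mem_admissibleActions hU
  obtain ⟨C, hC0, hC⟩ := exists_dotProduct_mulVec_le P.jointB
  refine ⟨C * R, by positivity, fun v hv q q' => ?_⟩
  have : P.controlHamiltonian q v - P.controlHamiltonian q' v =
      (q - q') ⬝ᵥ (P.jointB *ᵥ v) := by
    simp only [controlHamiltonian, sub_dotProduct]; ring
  rw [this]
  calc _ ≤ C * ‖q - q'‖ * ‖v‖ := hC _ _
    _ ≤ C * ‖q - q'‖ * R := by gcongr; exact hR v hv
    _ = C * R * ‖q - q'‖ := by ring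

theorem exists_abs_controlHamiltonian_le (hU : ∀ k, IsCompact (P.U k)) (D : ℝ) :
    ∃ C, ∀ v ∈ P.admissibleActions, ∀ q : Stacked d, ‖q‖ ≤ D →
      |P.controlHamiltonian q v| ≤ C := by
  obtain ⟨C, hC0, hC⟩ := P.exists_abs_controlHamiltonian_sub_le hU
  obtain ⟨G, hG⟩ := P.exists_abs_reward_le
  refine ⟨C * D + G, fun v hv q hq => ?_⟩
  have h1 := hC v hv q 0
  have h2 : P.controlHamiltonian 0 v = P.reward v := by simp [controlHamiltonian]
  rw [h2, sub_zero] at h1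
  have h3 : C * ‖q‖ ≤ C * D := by gcongr
  have h4 := hG v
  rw [abs_le] at *
  constructor <;> linarith

variable {P} {x : ℝ → Stacked d} {u : ℝ → Stacked m}

theorem _root_.IntervalIntegrable.of_norm_le {E : Type*} [NormedAddCommGroup E] {f : ℝ → E}
    {a b C : ℝ} (hab : a ≤ b) (hf : AEStronglyMeasurable f (volume.restrict (Icc a b)))
    (hC : ∀ t ∈ Icc a b, ‖f t‖ ≤ C) : IntervalIntegrable f volume a b := by
  rw [intervalIntegrable_iff_integrableOn_Icc_of_le hab]
  exact Integrable.of_bound hf C ((ae_restrict_iff' measurableSet_Icc).2 (ae_of_all _ hC))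

theorem IsAdmissible.intervalIntegrable_controlHamiltonian (h : P.IsAdmissible x u)
    (hU : ∀ k, IsCompact (P.U k)) (hT : 0 ≤ P.T) {p : ℝ → Stacked d} (hp : Continuous p) :
    IntervalIntegrable (fun t => P.controlHamiltonian (p t) (u t)) volume 0 P.T := by
  obtain ⟨D, hD⟩ := (isCompact_Icc (a := 0) (b := P.T)).exists_bound_of_continuousOn
    hp.continuousOn
  obtain ⟨C, hC⟩ := P.exists_abs_controlHamiltonian_le hU D
  refine .of_norm_le hT (AEMeasurable.aestronglyMeasurable ?_)
    fun t ht => hC _ (h.mem t ht) _ (hD t ht)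
  refine AEMeasurable.add ?_ (P.measurable_reward.comp_aemeasurable h.measurable)
  have hc : Continuous fun z : Stacked d × Stacked m => z.1 ⬝ᵥ (P.jointB *ᵥ z.2) :=
    continuous_fst.dotProduct (continuous_const.matrix_mulVec continuous_snd)
  exact hc.measurable.comp_aemeasurable (hp.measurable.aemeasurable.prodMk h.measurable)

theorem IsAdmissible.intervalIntegrable_reward (h : P.IsAdmissible x u) (hT : 0 ≤ P.T) :
    IntervalIntegrable (fun t => P.reward (u t)) volume 0 P.T := by
  obtain ⟨C, hC⟩ := P.exists_abs_reward_le
  exact .of_norm_le hT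
    (P.measurable_reward.comp_aemeasurable h.measurable).aestronglyMeasurable fun t _ => hC _

/-! ### Needle variations. -/

/-- The control perturbation that replaces the action by `v` on `s`. -/
def needle (u : ℝ → Stacked m) (v : Stacked m) (s : Set ℝ) : ℝ → Stacked m :=
  s.indicator fun t => v - u t

/-- The change of the state caused by a needle. -/
def needleResponse (P : MayerData N d m) (u : ℝ → Stacked m) (v : Stacked m) (s : Set ℝ) :
    ℝ → Stacked d :=
  forcedResponse P.jointA fun t => P.jointB *ᵥ needle u v s t

theorem add_needle_mem (h : P.IsAdmissible x u) {v : Stacked m} (hv : v ∈ P.admissibleActions)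
    (s : Set ℝ) {t : ℝ} (ht : t ∈ Icc 0 P.T) : u t + needle u v s t ∈ P.admissibleActions := by
  by_cases hts : t ∈ s
  · simpa [needle, hts] using hv
  · simpa [needle, hts] using h.mem t ht

theorem aemeasurable_needle (h : P.IsAdmissible x u) (v : Stacked m) {s : Set ℝ}
    (hs : MeasurableSet s) : AEMeasurable (needle u v s) (volume.restrict (Icc 0 P.T)) :=
  (h.measurable.const_sub v).indicator hs

theorem intervalIntegrable_needle (h : P.IsAdmissible x u)
    (hU : ∀ k, IsCompact (P.U k)) (hT : 0 ≤ P.T) (v : Stacked m) {s : Set ℝ}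
    (hs : MeasurableSet s) :
    IntervalIntegrable (fun t => P.jointB *ᵥ needle u v s t) volume 0 P.T := by
  obtain ⟨R, hR0, hR⟩ := P.exists_norm_le_of_mem_admissibleActions hU
  have h1 : IntervalIntegrable (needle u v s) volume 0 P.T := by
    refine .of_norm_le (C := ‖v‖ + R) hT (aemeasurable_needle h v hs).aestronglyMeasurable
      fun t ht => ?_
    refine (norm_indicator_le_norm_self _ _).trans ((norm_sub_le _ _).trans ?_)
    gcongr
    exact hR _ (h.mem t ht)
  exact h1.continuous_mulVec continuous_const

theorem IsAdmissible.add_needle (h : P.IsAdmissible x u)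
    (hU : ∀ k, IsCompact (P.U k)) (hT : 0 ≤ P.T) {v : Stacked m} (hv : v ∈ P.admissibleActions)
    {s : Set ℝ} (hs : MeasurableSet s) :
    P.IsAdmissible (fun t => x t + P.needleResponse u v s t) (fun t => u t + needle u v s t) where
  measurable := h.measurable.add (aemeasurable_needle h v hs)
  mem t ht := add_needle_mem h hv s ht
  absCont := h.absCont.add
    (absolutelyContinuousOnInterval_forcedResponse (intervalIntegrable_needle h hU hT v hs))
  init := by simp [needleResponse, forcedResponse_zero, h.init]
  dynamics := by
    have h1 := ae_hasDerivAt_forcedResponse (A := P.jointA)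
      (intervalIntegrable_needle h hU hT v hs)
    filter_upwards [h.dynamics, ae_restrict_of_ae h1, ae_restrict_mem measurableSet_Icc]
      with t ht1 ht2 ht3
    refine (ht1.add (ht2 (by rwa [uIcc_of_le hT]))).congr_deriv ?_
    rw [Matrix.mulVec_add, Matrix.mulVec_add]
    simp only [needleResponse]
    abel

/-- The terminal costate is minus the gradient of the terminal cost. -/
def terminalCostate (P : MayerData N d m) (x : ℝ → Stacked d) : Stacked d :=
  -(P.jointQhat *ᵥ (x P.T - stack P.xFin))

/-- The costate along the trajectory `x`. -/
def costate (P : MayerData N d m) (x : ℝ → Stacked d) : ℝ → Stacked d :=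
  adjointResponse P.jointA P.T (P.terminalCostate x)

theorem _root_.Matrix.IsSymm.quadratic_add {ι : Type*} [Fintype ι] {Q : Matrix ι ι ℝ}
    (hQ : Q.IsSymm) (a b : ι → ℝ) :
    (a + b) ⬝ᵥ (Q *ᵥ (a + b)) = a ⬝ᵥ (Q *ᵥ a) + 2 * ((Q *ᵥ a) ⬝ᵥ b) + b ⬝ᵥ (Q *ᵥ b) := by
  have h : a ⬝ᵥ (Q *ᵥ b) = (Q *ᵥ a) ⬝ᵥ b := by
    rw [Matrix.dotProduct_mulVec, ← Matrix.mulVec_transpose, hQ.eq]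
  rw [Matrix.mulVec_add, add_dotProduct, dotProduct_add, dotProduct_add, h,
    dotProduct_comm b (Q *ᵥ a)]
  ring

/-- An identity without remainder: the shift of the state is exact by linearity, the terminal cost
is quadratic, and the linear term is rewritten by `dotProduct_forcedResponse`. -/
theorem IsAdmissible.cost_add_needle (h : P.IsAdmissible x u)
    (hU : ∀ k, IsCompact (P.U k)) (hT : 0 ≤ P.T) (hQ : P.jointQhat.IsSymm)
    {v : Stacked m} (hv : v ∈ P.admissibleActions) {s : Set ℝ} (hs : MeasurableSet s) :
    P.cost (fun t => x t + P.needleResponse u v s t) (fun t => u t + needle u v s t) =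
      P.cost x u
      - (∫ t in (0 : ℝ)..P.T, s.indicator (fun t => P.controlHamiltonian (P.costate x t) v
          - P.controlHamiltonian (P.costate x t) (u t)) t)
      + (1 / 2) * (P.needleResponse u v s P.T ⬝ᵥ
          (P.jointQhat *ᵥ P.needleResponse u v s P.T)) := by
  have hint := intervalIntegrable_needle h hU hT v hs
  have hadm := h.add_needle hU hT hv hs
  have hpair := dotProduct_forcedResponse (A := P.jointA) (P.terminalCostate x) hint
  have hpi : IntervalIntegrable
      -- This pairing is the difference of the Hamiltonians of the two controls minus that of their
      -- rewards, all of them integrable.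
      (fun t => P.costate x t ⬝ᵥ (P.jointB *ᵥ needle u v s t)) volume 0 P.T := by
    have h1 := hadm.intervalIntegrable_controlHamiltonian hU hT
      (continuous_adjointResponse (A := P.jointA) (T := P.T) (P.terminalCostate x))
    have h2 := h.intervalIntegrable_controlHamiltonian hU hT
      (continuous_adjointResponse (A := P.jointA) (T := P.T) (P.terminalCostate x))
    have h3 := (h1.sub h2).sub
      ((hadm.intervalIntegrable_reward hT).sub (h.intervalIntegrable_reward hT))
    refine h3.congr fun t _ => ?_
    simp only [controlHamiltonian, Matrix.mulVec_add, dotProduct_add, costate]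
    ring
  have hI : (∫ t in (0 : ℝ)..P.T, s.indicator (fun t => P.controlHamiltonian (P.costate x t) v
          - P.controlHamiltonian (P.costate x t) (u t)) t) =
      P.terminalCostate x ⬝ᵥ P.needleResponse u v s P.T +
        ((∫ t in (0 : ℝ)..P.T, P.reward (u t + needle u v s t)) -
          ∫ t in (0 : ℝ)..P.T, P.reward (u t)) := by
    rw [needleResponse, hpair]
    change _ = (∫ t in (0 : ℝ)..P.T, P.costate x t ⬝ᵥ (P.jointB *ᵥ needle u v s t)) + _
    rw [← intervalIntegral.integral_sub
      (hadm.intervalIntegrable_reward hT) (h.intervalIntegrable_reward hT),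
      ← intervalIntegral.integral_add hpi ((hadm.intervalIntegrable_reward hT).sub
        (h.intervalIntegrable_reward hT))]
    refine intervalIntegral.integral_congr fun t _ => ?_
    by_cases hts : t ∈ s
    · simp only [needle, hts, indicator_of_mem, controlHamiltonian, costate,
        Matrix.mulVec_sub, dotProduct_sub, add_sub_cancel]
      ring
    · simp [needle, hts]
  have hq := hQ.quadratic_add (x P.T - stack P.xFin) (P.needleResponse u v s P.T)
  have hx : x P.T + P.needleResponse u v s P.T - stack P.xFin =
      x P.T - stack P.xFin + P.needleResponse u v s P.T := by abel
  simp only [cost]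
  rw [hx, hq, hI, terminalCostate, neg_dotProduct]
  simp only [reward]
  ring

theorem jointQhat_isSymm (hQ : ∀ k, (P.Qhat k).PosSemidef) : P.jointQhat.IsSymm := by
  rw [Matrix.IsSymm, jointQhat, Matrix.blockDiagonal'_transpose]
  congr 1
  funext k
  simpa [Matrix.IsHermitian, Matrix.conjTranspose_eq_transpose_of_trivial] using (hQ k).1

/-- The forcing is bounded by some `D` and lives on an interval of length `r`, so its `L¹` norm is
at most `D * r`, uniformly in `τ`. -/
theorem exists_norm_needleResponse_le (h : P.IsAdmissible x u)
    (hU : ∀ k, IsCompact (P.U k)) (hT : 0 ≤ P.T) (v : Stacked m) :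
    ∃ K, 0 ≤ K ∧ ∀ τ r, 0 ≤ τ → 0 ≤ r → τ + r ≤ P.T → ∀ t ∈ Icc 0 P.T,
      ‖P.needleResponse u v (Ioc τ (τ + r)) t‖ ≤ K * r := by
  obtain ⟨R, hR0, hR⟩ := P.exists_norm_le_of_mem_admissibleActions hU
  obtain ⟨K, hK0, hK⟩ := exists_norm_forcedResponse_le P.jointA hT
  obtain ⟨D, hD⟩ := (isCompact_closedBall (0 : Stacked m) (‖v‖ + R)).exists_bound_of_continuousOn
    (f := fun z => P.jointB *ᵥ z) (continuous_const.matrix_mulVec continuous_id).continuousOn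
  have hD0 : 0 ≤ D := (norm_nonneg _).trans (hD 0 (by simp; positivity))
  refine ⟨K * D, by positivity, fun τ r hτ hr hτr t ht => ?_⟩
  have hint := intervalIntegrable_needle h hU hT v (measurableSet_Ioc (a := τ) (b := τ + r))
  refine (hK _ hint t ht).trans ?_
  rw [mul_assoc]
  gcongr
  have hind : ∀ s, ‖P.jointB *ᵥ needle u v (Ioc τ (τ + r)) s‖ =
      (Ioc τ (τ + r)).indicator (fun s => ‖P.jointB *ᵥ (v - u s)‖) s := fun s => by
    by_cases hs : s ∈ Ioc τ (τ + r) <;> simp [needle, hs]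
  calc _ ≤ ∫ s in (0 : ℝ)..P.T, (Ioc τ (τ + r)).indicator (fun _ => D) s := by
        refine intervalIntegral.integral_mono_on hT hint.norm ?_ fun s hs => ?_
        · exact .of_norm_le (C := D) hT
            (measurable_const.indicator measurableSet_Ioc).aestronglyMeasurable fun s _ =>
              (norm_indicator_le_norm_self _ _).trans (by simp [abs_of_nonneg hD0])
        · rw [hind]
          refine indicator_le_indicator' fun _ => hD _ ?_
          rw [mem_closedBall_zero_iff]
          exact (norm_sub_le _ _).trans (by gcongr; exact hR _ (h.mem s hs))
    _ = D * r := by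
        rw [intervalIntegral.integral_of_le hT, setIntegral_indicator measurableSet_Ioc,
          inter_eq_right.2 (Ioc_subset_Ioc hτ hτr)]
        simp [hr, mul_comm]

/-! ### The maximum condition for the joint system. -/

/-- The maximum condition holds wherever the integral of the Hamiltonian along the trajectory
is differentiable with the expected derivative. -/
theorem IsLocalMinimizer.controlHamiltonian_le (hmin : P.IsLocalMinimizer x u)
    (hU : ∀ k, IsCompact (P.U k)) (hQ : ∀ k, (P.Qhat k).PosSemidef) {τ : ℝ}
    (hτ : τ ∈ Ioo 0 P.T)
    (hd : HasDerivAt (fun t => ∫ s in (0 : ℝ)..t, P.controlHamiltonian (P.costate x s) (u s))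
      (P.controlHamiltonian (P.costate x τ) (u τ)) τ)
    {v : Stacked m} (hv : v ∈ P.admissibleActions) :
    P.controlHamiltonian (P.costate x τ) v ≤ P.controlHamiltonian (P.costate x τ) (u τ) := by
  obtain ⟨hadm, ε, hε, hloc⟩ := hmin
  have hT : 0 ≤ P.T := (hτ.1.trans hτ.2).le
  obtain ⟨K, hK0, hK⟩ := exists_norm_needleResponse_le hadm hU hT v
  obtain ⟨E, hE0, hE⟩ := exists_euclNorm_le d
  obtain ⟨C, hC0, hC⟩ := exists_dotProduct_mulVec_le P.jointQhat
  have hpc : Continuous (P.costate x) := continuous_adjointResponse _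
  have hcont : Continuous fun t => P.controlHamiltonian (P.costate x t) v :=
    (hpc.dotProduct continuous_const).add continuous_const
  have hd1 : HasDerivAt (fun t => ∫ s in (0 : ℝ)..t, P.controlHamiltonian (P.costate x s) v)
      (P.controlHamiltonian (P.costate x τ) v) τ :=
    intervalIntegral.integral_hasDerivAt_right (hcont.intervalIntegrable _ _)
      (hcont.stronglyMeasurableAtFilter _ _) hcont.continuousAt
  have hui := hadm.intervalIntegrable_controlHamiltonian hU hT hpc
  have hsub : ∀ {a b}, a ∈ Icc 0 P.T → b ∈ Icc 0 P.T → IntervalIntegrable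
      (fun t => P.controlHamiltonian (P.costate x t) (u t)) volume a b := fun {a b} ha hb =>
    hui.mono_set (by rw [uIcc_of_le hT]; exact uIcc_subset_Icc ha hb)
  have h0mem : (0 : ℝ) ∈ Icc 0 P.T := ⟨le_rfl, hT⟩
  have hτmem : τ ∈ Icc 0 P.T := Ioo_subset_Icc_self hτ
  refine sub_nonpos.1 ((hd1.sub hd).nonpos_of_sub_le_sq
    -- The first bound keeps the needle inside `[0, P.T]`, the second keeps the perturbed state
    -- within `ε`. The constant `C` comes from the quadratic term with a shift of norm at most `K *
    -- r`.
    (h₀ := min (P.T - τ) (ε / (E * K + 1))) (C := (1 / 2) * (C * K * K))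
    (lt_min (by linarith [hτ.2]) (by positivity)) fun r hr => ?_)
  have hr0 : 0 < r := hr.1
  have hrT : τ + r ≤ P.T := by linarith [hr.2.le.trans (min_le_left _ _)]
  have hrε : E * (K * r) ≤ ε := by
    have h1 : r * (E * K + 1) ≤ ε :=
      (le_div_iff₀ (by positivity)).1 (hr.2.le.trans (min_le_right _ _))
    nlinarith
  have hrmem : τ + r ∈ Icc 0 P.T := ⟨by linarith [hτ.1], hrT⟩
  have hKr := hK τ r hτ.1.le hr0.le hrT
  set s := Ioc τ (τ + r) with hs
  have hsm : MeasurableSet s := measurableSet_Ioc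
  have hle := hloc _ _ (hadm.add_needle hU hT hv hsm) fun t ht => by
    rw [add_sub_cancel_left]
    exact (hE _).trans ((mul_le_mul_of_nonneg_left (hKr t ht) hE0).trans hrε)
  rw [hadm.cost_add_needle hU hT (jointQhat_isSymm hQ) hv hsm] at hle
  have hquad := (le_abs_self _).trans
    (hC (P.needleResponse u v s P.T) (P.needleResponse u v s P.T))
  have hn := hKr P.T ⟨hT, le_rfl⟩
  have hquad2 : C * ‖P.needleResponse u v s P.T‖ * ‖P.needleResponse u v s P.T‖ ≤
      C * (K * r) * (K * r) := by gcongr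
  have hI : (∫ t in (0 : ℝ)..P.T, s.indicator (fun t => P.controlHamiltonian (P.costate x t) v
          - P.controlHamiltonian (P.costate x t) (u t)) t) =
      (∫ t in τ..(τ + r), P.controlHamiltonian (P.costate x t) v) -
        ∫ t in τ..(τ + r), P.controlHamiltonian (P.costate x t) (u t) := by
    rw [intervalIntegral.integral_of_le hT, setIntegral_indicator hsm,
      inter_eq_right.2 (Ioc_subset_Ioc hτ.1.le hrT), ← intervalIntegral.integral_of_le
      (by linarith), intervalIntegral.integral_sub (hcont.intervalIntegrable _ _)
      (hsub hτmem hrmem)]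
  have e1 := intervalIntegral.integral_interval_sub_left
    (hcont.intervalIntegrable (μ := volume) 0 (τ + r)) (hcont.intervalIntegrable 0 τ)
  have e2 := intervalIntegral.integral_interval_sub_left (hsub h0mem hrmem) (hsub h0mem hτmem)
  simp only [Pi.sub_apply]
  nlinarith

/-- The supremum of the Hamiltonian over the admissible joint actions. -/
def supHamiltonian (P : MayerData N d m) (q : Stacked d) : ℝ :=
  sSup (P.controlHamiltonian q '' P.admissibleActions)

theorem bddAbove_controlHamiltonian (hU : ∀ k, IsCompact (P.U k)) (q : Stacked d) :
    BddAbove (P.controlHamiltonian q '' P.admissibleActions) := by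
  obtain ⟨C, hC⟩ := P.exists_abs_controlHamiltonian_le hU ‖q‖
  exact ⟨C, by rintro _ ⟨v, hv, rfl⟩; exact (le_abs_self _).trans (hC v hv q le_rfl)⟩

theorem controlHamiltonian_le_supHamiltonian (hU : ∀ k, IsCompact (P.U k)) (q : Stacked d)
    {v : Stacked m} (hv : v ∈ P.admissibleActions) :
    P.controlHamiltonian q v ≤ P.supHamiltonian q :=
  le_csSup (bddAbove_controlHamiltonian hU q) ⟨v, hv, rfl⟩

theorem exists_lipschitzWith_supHamiltonian (hU : ∀ k, IsCompact (P.U k))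
    (hne : P.admissibleActions.Nonempty) : ∃ K, LipschitzWith K P.supHamiltonian := by
  obtain ⟨C, hC0, hC⟩ := P.exists_abs_controlHamiltonian_sub_le hU
  refine ⟨⟨C, hC0⟩, LipschitzWith.of_le_add_mul _ fun q q' => ?_⟩
  refine csSup_le (hne.image _) ?_
  rintro _ ⟨v, hv, rfl⟩
  have h1 := (le_abs_self _).trans (hC v hv q q')
  have h2 := controlHamiltonian_le_supHamiltonian hU q' hv
  rw [dist_eq_norm]
  change _ ≤ _ + C * _
  linarith

/-- The maximum condition for the joint system, at almost every time. -/
theorem IsLocalMinimizer.ae_controlHamiltonian_le (hmin : P.IsLocalMinimizer x u)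
    (hT : 0 ≤ P.T) (hU : ∀ k, IsCompact (P.U k)) (hQ : ∀ k, (P.Qhat k).PosSemidef) :
    ∀ᵐ t ∂(volume.restrict (Icc 0 P.T)), ∀ v ∈ P.admissibleActions,
      P.controlHamiltonian (P.costate x t) v ≤ P.controlHamiltonian (P.costate x t) (u t) := by
  have hint := hmin.1.intervalIntegrable_controlHamiltonian hU hT
    (p := P.costate x) (continuous_adjointResponse _)
  have hne : ∀ a : ℝ, ∀ᵐ t, t ≠ a := fun a => by simp [ae_iff, measure_singleton]
  -- The exceptional set comes from the integral along `u` alone, so one null set serves every `v`.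
  filter_upwards [ae_restrict_of_ae hint.ae_hasDerivAt_integral, ae_restrict_of_ae (hne 0),
    ae_restrict_of_ae (hne P.T), ae_restrict_mem measurableSet_Icc] with t ht h0 h1 hmem v hv
  exact hmin.controlHamiltonian_le hU hQ ⟨lt_of_le_of_ne hmem.1 h0.symm, lt_of_le_of_ne hmem.2 h1⟩
    (ht (by rwa [uIcc_of_le hT]) 0 (by simp)) hv

theorem absolutelyContinuousOnInterval_costate :
    AbsolutelyContinuousOnInterval (P.costate x) 0 P.T :=
  absolutelyContinuousOnInterval_adjointResponse _ _ _

theorem hasDerivAt_costate (t : ℝ) :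
    HasDerivAt (P.costate x) (-(P.jointAᵀ *ᵥ P.costate x t)) t :=
  hasDerivAt_adjointResponse _ t

/-! ### Constancy of the Hamiltonian. -/

/-- The full Hamiltonian is constant along an admissible trajectory that satisfies the maximum
condition. -/
theorem IsAdmissible.exists_hamiltonian_ae_eq (hadm : P.IsAdmissible x u)
    (hT : 0 ≤ P.T) (hU : ∀ k, IsCompact (P.U k))
    (hmax : ∀ᵐ t ∂(volume.restrict (Icc 0 P.T)), ∀ v ∈ P.admissibleActions,
      P.controlHamiltonian (P.costate x t) v ≤ P.controlHamiltonian (P.costate x t) (u t)) :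
    ∃ h : ℝ, ∀ᵐ t ∂(volume.restrict (Icc 0 P.T)),
      P.costate x t ⬝ᵥ (P.jointA *ᵥ x t + P.jointB *ᵥ u t) + P.reward (u t) = h := by
  have hsup : ∀ᵐ t ∂(volume.restrict (Icc 0 P.T)),
      P.supHamiltonian (P.costate x t) = P.controlHamiltonian (P.costate x t) (u t) := by
    filter_upwards [hmax, ae_restrict_mem measurableSet_Icc] with t ht hmem
    refine IsGreatest.csSup_eq ⟨⟨u t, hadm.mem t hmem, rfl⟩, ?_⟩
    rintro _ ⟨v, hv, rfl⟩
    exact ht v hv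
  obtain ⟨K, hK⟩ := exists_lipschitzWith_supHamiltonian hU ⟨u 0, hadm.mem 0 ⟨le_rfl, hT⟩⟩
  have hacs := (absolutelyContinuousOnInterval_costate (P := P) (x := x)).lipschitz_comp hK
  have hAac : AbsolutelyContinuousOnInterval (fun t => P.jointA *ᵥ x t) 0 P.T :=
    AbsolutelyContinuousOnInterval.mulVec
      (fun j => (LipschitzWith.const _).lipschitzOnWith.absolutelyContinuousOnInterval)
      fun j => hadm.absCont.eval_pi j
  have hac := ((absolutelyContinuousOnInterval_costate (x := x)).dotProduct hAac).add hacs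
  have hzero : ∀ᵐ t, t ∈ uIcc 0 P.T → HasDerivAt
      ((fun t => P.costate x t ⬝ᵥ (P.jointA *ᵥ x t)) +
        fun t => P.supHamiltonian (P.costate x t)) 0 t := by
    rw [uIcc_of_le hT]
    filter_upwards [hacs.ae_differentiableAt, (ae_restrict_iff' measurableSet_Icc).1 hsup,
      (ae_restrict_iff' measurableSet_Icc).1 hadm.dynamics] with t ht1 ht2 ht3 hmem
    have hdiff := (ht1 (by rwa [uIcc_of_le hT])).hasDerivAt
    have hp := hasDerivAt_costate (P := P) (x := x) t
    have hlin : HasDerivAt (fun s => P.controlHamiltonian (P.costate x s) (u t))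
        (-(P.jointAᵀ *ᵥ P.costate x t) ⬝ᵥ (P.jointB *ᵥ u t)) t := by
      have h1 := (hp.dotProduct (hasDerivAt_const t (P.jointB *ᵥ u t))).add_const (P.reward (u t))
      exact h1.congr_deriv (by simp)
    -- Envelope argument: with the action frozen at `u t`, the gap to the supremum is nonnegative
    -- and vanishes at `s = t`, so both functions have the same derivative there.
    have hgap : IsLocalMin (fun s => P.supHamiltonian (P.costate x s) -
        P.controlHamiltonian (P.costate x s) (u t)) t := by
      refine Eventually.of_forall fun s => ?_
      simp only
      rw [ht2 hmem, sub_self]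
      exact sub_nonneg.2 (controlHamiltonian_le_supHamiltonian hU _ (hadm.mem t hmem))
    have henv := hgap.hasDerivAt_eq_zero (hdiff.sub hlin)
    have hAx : HasDerivAt (fun s => P.jointA *ᵥ x s)
        (P.jointA *ᵥ (P.jointA *ᵥ x t + P.jointB *ᵥ u t)) t := by
      simpa using HasDerivAt.mulVec (M' := 0) (fun i j => hasDerivAt_const t (P.jointA i j))
        (ht3 hmem)
    refine ((hp.dotProduct hAx).add hdiff).congr_deriv ?_
    have hA : ∀ a b, a ⬝ᵥ (P.jointA *ᵥ b) = (P.jointAᵀ *ᵥ a) ⬝ᵥ b := fun a b => by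
      rw [Matrix.dotProduct_mulVec, Matrix.mulVec_transpose]
    rw [sub_eq_zero.1 henv, Matrix.mulVec_add, dotProduct_add, hA _ (P.jointB *ᵥ u t),
      hA _ (P.jointA *ᵥ x t)]
    simp only [neg_dotProduct, hA, Matrix.mulVec_neg]
    ring
  obtain ⟨h, hh⟩ := hac.const_of_ae_hasDerivAt_zero hzero
  refine ⟨h, ?_⟩
  filter_upwards [hsup, ae_restrict_mem measurableSet_Icc] with t ht hmem
  have := hh t (by rwa [uIcc_of_le hT])
  rw [Pi.add_apply, ht] at this
  rw [← this, dotProduct_add, controlHamiltonian, add_assoc]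

/-! ### Splitting the joint condition into single systems. -/

theorem gain_eq (k : Fin N) (q : Fin (d k) → ℝ) (v : Fin (m k) → ℝ) :
    P.gain k q v = q ⬝ᵥ (P.B k *ᵥ v) := by
  rw [gain, Matrix.dotProduct_mulVec, Matrix.mulVec_transpose]

theorem block_jointB_mulVec (v : Stacked m) (k : Fin N) :
    block (P.jointB *ᵥ v) k = P.B k *ᵥ block v k := by
  funext i
  simp only [block, Matrix.mulVec, dotProduct, jointB, Fintype.sum_sigma]
  rw [Finset.sum_eq_single k]
  · simp
  · intro l _ hl
    simp [Matrix.blockDiagonal'_apply_ne _ _ _ hl.symm]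
  · simp

theorem controlHamiltonian_eq_sum (q : Stacked d) (v : Stacked m) :
    P.controlHamiltonian q v = ∑ k, P.gain k (block q k) (block v k) + P.reward v := by
  simp only [controlHamiltonian, gain_eq, ← block_jointB_mulVec]
  rw [dotProduct, Fintype.sum_sigma]
  rfl

/-- Silent blocks have zero gain and full reward; their rewards sum to `lamCompl`. -/
theorem controlHamiltonian_eq_of_block_eq_zero (q : Stacked d) {v : Stacked m} {k : Fin N}
    (hv : ∀ l, l ≠ k → block v l = 0) :
    P.controlHamiltonian q v =
      P.gain k (block q k) (block v k) + P.lam k * indZero (block v k) + P.lamCompl k := by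
  rw [controlHamiltonian_eq_sum, reward, lamCompl,
    ← Finset.add_sum_erase _ (fun k => P.lam k * indZero (block v k)) (Finset.mem_univ k),
    Finset.sum_eq_single k]
  · rw [← add_assoc]
    congr 1
    refine Finset.sum_congr rfl fun l hl => ?_
    rw [hv l (Finset.ne_of_mem_erase hl), indZero_zero, mul_one]
  · intro l _ hl
    simp [gain, hv l hl]
  · simp

theorem block_stack {n : Fin N → ℕ} (z : ∀ k, Fin (n k) → ℝ) (k : Fin N) :
    block (stack z) k = z k := rfl

theorem isGreatest_maxGain (hU : ∀ k, IsCompact (P.U k)) (hU0 : ∀ k, (0 : Fin (m k) → ℝ) ∈ P.U k)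
    (k : Fin N) (q : Fin (d k) → ℝ) : IsGreatest (P.gain k q '' P.U k) (P.maxGain k q) := by
  have hcont : Continuous (P.gain k q) := continuous_const.dotProduct continuous_id
  obtain ⟨w, hw, hmax⟩ := (hU k).exists_isMaxOn ⟨0, hU0 k⟩ hcont.continuousOn
  have hg : IsGreatest (P.gain k q '' P.U k) (P.gain k q w) :=
    ⟨⟨w, hw, rfl⟩, by rintro _ ⟨v, hv, rfl⟩; exact hmax hv⟩
  rw [maxGain, maxOn, hg.csSup_eq]; exact hg

/-- Maximizers of the single-system Hamiltonian are candidate control actions. -/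
theorem mem_activeSet_of_isMax (hU : ∀ k, IsCompact (P.U k))
    (hU0 : ∀ k, (0 : Fin (m k) → ℝ) ∈ P.U k) (hlam : ∀ k, 0 < P.lam k) {k : Fin N}
    {q : Fin (d k) → ℝ} {v : Fin (m k) → ℝ} (hv : v ∈ P.U k)
    (hmax : ∀ w ∈ P.U k, P.gain k q w + P.lam k * indZero w ≤
      P.gain k q v + P.lam k * indZero v) : v ∈ P.activeSet k q := by
  obtain ⟨⟨w, hw, hwM⟩, hM⟩ := isGreatest_maxGain hU hU0 k q
  have hg0 : P.gain k q 0 = 0 := by simp [gain]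
  have hle : ∀ z ∈ P.U k, P.gain k q z ≤ P.maxGain k q := fun z hz => hM ⟨z, hz, rfl⟩
  have hw' : P.maxGain k q ≤ P.gain k q w + P.lam k * indZero w := by
    rw [hwM]; linarith [mul_nonneg (hlam k).le (indZero_nonneg w)]
  -- The value at `v` dominates `maxGain`: for `v = 0` this says `maxGain ≤ λ`, for `v ≠ 0` it makes
  -- `v` a maximizer of the gain.
  have hmw := hw'.trans (hmax w hw)
  have harg : v ≠ 0 → v ∈ argmaxOn (P.U k) (P.gain k q) := fun hv0 => by
    rw [indZero_of_ne hv0] at hmw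
    exact ⟨hv, fun z hz => (hle z hz).trans (by linarith)⟩
  by_cases hv0 : v = 0
  · subst hv0
    rw [hg0, indZero_zero] at hmw
    rw [activeSet, if_neg (by linarith)]
    split_ifs <;> simp
  -- Comparison with `0` gives `λ ≤ maxGain`, which excludes the last case.
  · have h0 := hmax 0 (hU0 k)
    rw [hg0, indZero_zero, indZero_of_ne hv0] at h0
    have h1 := hle v hv
    rw [activeSet]
    split_ifs with c1 c2
    · exact harg hv0
    · exact Or.inr (harg hv0)
    · exact absurd (le_antisymm (not_lt.1 c1) (by linarith)) c2

/-- Test the joint condition against actions with a single block `w` at `l`. Taking `l = k` gives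
the second claim, arbitrary `l` the first. The block at `k` may itself be zero. -/
theorem mem_argmaxOn_maxHamiltonian (hU : ∀ k, IsCompact (P.U k))
    (hU0 : ∀ k, (0 : Fin (m k) → ℝ) ∈ P.U k) (hlam : ∀ k, 0 < P.lam k) {q : Stacked d}
    {v : Stacked m} {k : Fin N} (hvk : block v k ∈ P.U k) (hv : ∀ l, l ≠ k → block v l = 0)
    (hmax : ∀ w ∈ P.admissibleActions, P.controlHamiltonian q w ≤ P.controlHamiltonian q v) :
    k ∈ argmaxOn univ (fun k => P.maxHamiltonian k (block q k)) ∧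
      block v k ∈ P.activeSet k (block q k) := by
  have hbound : ∀ l, ∀ w ∈ P.U l,
      P.gain l (block q l) w + P.lam l * indZero w + P.lamCompl l ≤
        P.gain k (block q k) (block v k) + P.lam k * indZero (block v k) + P.lamCompl k := by
    intro l w hw
    have hz : ∀ j, j ≠ l → block (stack (Pi.single l w)) j = 0 := fun j hj => by
      rw [block_stack, Pi.single_eq_of_ne hj]
    have h := hmax (stack (Pi.single l w)) ⟨l, by rwa [block_stack, Pi.single_eq_same], hz⟩
    rwa [controlHamiltonian_eq_of_block_eq_zero q hz, controlHamiltonian_eq_of_block_eq_zero q hv,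
      block_stack, Pi.single_eq_same] at h
  refine ⟨⟨mem_univ k, fun l _ => ?_⟩, ?_⟩
  · obtain ⟨⟨w, hw, hwl⟩, -⟩ := isGreatest_maxOn_hamiltonian (hU l) (hU0 l)
      ((P.B l)ᵀ *ᵥ block q l) (hlam l).le (P.lamCompl l)
    have hk := (isGreatest_maxOn_hamiltonian (hU k) (hU0 k)
      ((P.B k)ᵀ *ᵥ block q k) (hlam k).le (P.lamCompl k)).2 ⟨block v k, hvk, rfl⟩
    exact (hwl.symm.le.trans (hbound l w hw)).trans hk
  · exact mem_activeSet_of_isMax hU hU0 hlam hvk fun w hw => by linarith [hbound k w hw]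

/-! ### Measurable choice of the active index. -/

open Classical in
/-- An index with the property `S` if there is one, and the default `k₀` otherwise. -/
def chooseIndex (k₀ : Fin N) (S : Fin N → Prop) : Fin N :=
  if h : ∃ k, S k then h.choose else k₀

/-- An index whose block is nonzero if there is one, and the default `k₀` otherwise. -/
def activeIndex (k₀ : Fin N) (v : Stacked m) : Fin N :=
  chooseIndex k₀ fun k => block v k ≠ 0

/-- The choice factors through the finite discrete space `Fin N → Prop`, where every map is
measurable; only the tests for nonzero blocks need an argument. -/
theorem measurable_activeIndex (k₀ : Fin N) :
    Measurable (activeIndex k₀ : Stacked m → Fin N) := by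
  have hS : Measurable fun (v : Stacked m) (k : Fin N) => block v k ≠ 0 :=
    measurable_pi_lambda _ fun k => measurableSet_setOfPred.1
      ((measurableSet_singleton (0 : Fin (m k) → ℝ)).compl.preimage
        (continuous_block k).measurable)
  exact (Measurable.of_discrete (f := chooseIndex k₀)).comp hS

/-- At most one block is nonzero, so the choice is forced whenever it matters. -/
theorem block_eq_zero_of_ne_activeIndex {v : Stacked m} (hv : v ∈ P.admissibleActions)
    (k₀ : Fin N) {l : Fin N} (hl : l ≠ activeIndex k₀ v) : block v l = 0 := by
  obtain ⟨k, -, hk⟩ := hv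
  by_contra hne
  have hex : ∃ k, block v k ≠ 0 := ⟨l, hne⟩
  rw [activeIndex, chooseIndex, dif_pos hex] at hl
  have h1 : l = k := by_contra fun h => hne (hk l h)
  have h2 : hex.choose = k := by_contra fun h => hex.choose_spec (hk _ h)
  exact hl (h1.trans h2.symm)

theorem block_mem_of_mem_admissibleActions (hU0 : ∀ k, (0 : Fin (m k) → ℝ) ∈ P.U k)
    {v : Stacked m} (hv : v ∈ P.admissibleActions) (l : Fin N) : block v l ∈ P.U l := by
  obtain ⟨k, hkU, hk⟩ := hv
  by_cases h : l = k
  · exact h ▸ hkU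
  · rw [hk l h]; exact hU0 l

end MayerData
end SparseMux
end

/-! ### Assembly of the maximum principle. -/

theorem theorem3 {N : ℕ} (hN : 0 < N) {d m : Fin N → ℕ} (P : SparseMux.MayerData N d m)
    (hT : 0 < P.T)
    (hU : ∀ k, IsCompact (P.U k)) (hU0 : ∀ k, (0 : Fin (m k) → ℝ) ∈ P.U k)
    (hQ : ∀ k, (P.Qhat k).PosSemidef) (hlam : ∀ k, 0 < P.lam k)
    (x : ℝ → SparseMux.Stacked d) (u : ℝ → SparseMux.Stacked m)
    (hmin : P.IsLocalMinimizer x u) :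
    ∃ (p : ℝ → SparseMux.Stacked d) (σ : ℝ → Fin N),
      AbsolutelyContinuousOnInterval p 0 P.T ∧
      AEMeasurable σ (volume.restrict (Icc 0 P.T)) ∧
      x 0 = SparseMux.stack P.xInit ∧
      p P.T = -(P.jointQhat *ᵥ (x P.T - SparseMux.stack P.xFin)) ∧
      (∀ᵐ t ∂(volume.restrict (Icc 0 P.T)),
        HasDerivAt x (P.jointA *ᵥ x t + P.jointB *ᵥ u t) t ∧
        HasDerivAt p (-(P.jointAᵀ *ᵥ p t)) t ∧
        (∀ k, (k = σ t → SparseMux.block (u t) k ∈ P.activeSet k (SparseMux.block (p t) k)) ∧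
          (k ≠ σ t → SparseMux.block (u t) k = 0)) ∧
        σ t ∈ SparseMux.argmaxOn univ
          (fun k => P.maxHamiltonian k (SparseMux.block (p t) k))) ∧
      ∃ h : ℝ, ∀ᵐ t ∂(volume.restrict (Icc 0 P.T)),
        p t ⬝ᵥ (P.jointA *ᵥ x t + P.jointB *ᵥ u t) +
          ∑ k, P.lam k * SparseMux.indZero (SparseMux.block (u t) k) = h := by

  have hadm := hmin.1
  have hmax := hmin.ae_controlHamiltonian_le hT.le hU hQ
  -- The default index `0` is used when `u t = 0`; any index would do then, since all blocks vanish
  -- and each `U k` contains `0`.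
  refine ⟨P.costate x, fun t => SparseMux.MayerData.activeIndex ⟨0, hN⟩ (u t),
    SparseMux.MayerData.absolutelyContinuousOnInterval_costate,
    (SparseMux.MayerData.measurable_activeIndex _).comp_aemeasurable hadm.measurable,
    hadm.init, adjointResponse_terminal _, ?_, hadm.exists_hamiltonian_ae_eq hT.le hU hmax⟩
  filter_upwards [hmax, hadm.dynamics, ae_restrict_mem measurableSet_Icc] with t ht hdyn hmem
  have hu := hadm.mem t hmem
  have hzero := fun l hl =>
    SparseMux.MayerData.block_eq_zero_of_ne_activeIndex hu ⟨0, hN⟩ (l := l) hl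
  obtain ⟨harg, hact⟩ := SparseMux.MayerData.mem_argmaxOn_maxHamiltonian hU hU0 hlam
    (SparseMux.MayerData.block_mem_of_mem_admissibleActions hU0 hu _) hzero ht
  refine ⟨hdyn, SparseMux.MayerData.hasDerivAt_costate t, fun k => ⟨?_, hzero k⟩, harg⟩
  rintro rfl
  exact hact
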